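/- Let $n \ge 0$ and let $Q_n$ be the $n$-dimensional hypercube, i.e. the graph whose vertices are the subsets of $\{1,\dots,n\}$, two of them being adjacent when they differ in exactly one element. Every real number $x$ with $1 \le x < 2^n$ can be written uniquely as \[ x=\sum_{i=0}^{k}\binom{n}{i}+\alpha\binom{n}{k+1}, \qquad 0\le k< n,\quad 0\le\alpha<1, \] with $k$ an integer and $\alpha$ real; put \[ b(x)=b_n(x)=(1-\alpha)\binom{n}{k+1}+\alpha\binom{n}{k+2}. \] **Theorem (Bollobás–Leader).** Let $A$ and $B$ be disjoint non-empty sets of vertices of $Q_n$. Then there is a family of at least $\min\{b(|A|),\,b(|B|)\}$ distinct paths from $A$ to $B$ with pairwise vertex-disjoint interiors. Here a path from $A$ to $B$ is a path in $Q_n$ whose first vertex lies in $A$, whose last vertex lies in $B$, and whose interior (the set of its vertices other than these two end vertices) contains no vertex of $A\cup B$. -/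

import Mathlib

/-- The `n`-dimensional hypercube: the vertices are the subsets of `[n]`, two of them being adjacent
when they differ in exactly one element. -/
def cube (n : ℕ) : SimpleGraph (Finset (Fin n)) where
  Adj x y := (symmDiff x y).card = 1
  symm := ⟨fun x y h => by rw [symmDiff_comm]; exact h⟩
  loopless := ⟨fun x h => by simp at h⟩

/-- The number of vertices of the `n`-cube of weight at most `k`. -/
def layerSum (n k : ℕ) : ℕ := ∑ i ∈ Finset.range (k + 1), n.choose i

open Classical in
/-- The largest `k ≤ n` with `∑ i ≤ k, (n choose i) ≤ x`. -/
noncomputable def levelOf (n : ℕ) (x : ℝ) : ℕ :=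
  Nat.findGreatest (fun k => (layerSum n k : ℝ) ≤ x) n

/-- The number `α` in `x = ∑ i ≤ k, (n choose i) + α * (n choose (k + 1))`, where `k = levelOf n x`. -/
noncomputable def fracOf (n : ℕ) (x : ℝ) : ℝ :=
  (x - layerSum n (levelOf n x)) / (n.choose (levelOf n x + 1) : ℝ)

/-- The function `b_n`: if `x = ∑ i ≤ k, (n choose i) + α * (n choose (k + 1))` with `0 ≤ α < 1`,
then `b_n x = (1 - α) * (n choose (k + 1)) + α * (n choose (k + 2))`. -/
noncomputable def isoBound (n : ℕ) (x : ℝ) : ℝ :=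
  (1 - fracOf n x) * (n.choose (levelOf n x + 1) : ℝ) +
    fracOf n x * (n.choose (levelOf n x + 2) : ℝ)

theorem layerSum_succ (n k : ℕ) : layerSum n (k + 1) = layerSum n k + n.choose (k + 1) := by
  simp [layerSum, Finset.sum_range_succ]

theorem layerSum_mono (n : ℕ) : Monotone (layerSum n) :=
  monotone_nat_of_le_succ fun k => by rw [layerSum_succ]; omega

/-- Every real number `x` with `1 ≤ x < 2 ^ n` has a representation as in the definition of
`isoBound`. -/
theorem exists_level (n : ℕ) (x : ℝ) (h1 : 1 ≤ x) (h2 : x < 2 ^ n) :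
    ∃ k < n, ∃ α : ℝ, 0 ≤ α ∧ α < 1 ∧ x = layerSum n k + α * (n.choose (k + 1) : ℝ) := by
  classical
  have hn : ¬ (layerSum n n : ℝ) ≤ x := by
    rw [layerSum, Nat.sum_range_choose]; push_cast; linarith
  have h0 : (layerSum n 0 : ℝ) ≤ x := by simpa [layerSum] using h1
  have hex : ∃ k, ¬ (layerSum n k : ℝ) ≤ x := ⟨n, hn⟩
  have hs := Nat.find_spec hex
  have hle : Nat.find hex ≤ n := Nat.find_min' hex hn
  obtain ⟨k, hk⟩ : ∃ k, Nat.find hex = k + 1 := by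
    rcases h : Nat.find hex with _ | k
    · rw [h] at hs; exact absurd h0 hs
    · exact ⟨k, rfl⟩
  have hlow : (layerSum n k : ℝ) ≤ x := by
    by_contra h
    have := Nat.find_min' hex h
    omega
  rw [hk, layerSum_succ] at hs
  push_cast at hs
  have hpos : (0 : ℝ) < (n.choose (k + 1) : ℝ) := by
    exact_mod_cast Nat.choose_pos (by omega)
  refine ⟨k, by omega, (x - layerSum n k) / (n.choose (k + 1) : ℝ),
    div_nonneg (by linarith) hpos.le, ?_, ?_⟩
  · rw [div_lt_one hpos]; linarith
  · field_simp; ring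

/-- The defining formula for `isoBound`; in particular the representation of `x` is unique. -/
theorem isoBound_eq (n k : ℕ) (hk : k < n) (α : ℝ) (h0 : 0 ≤ α) (h1 : α < 1) :
    levelOf n (layerSum n k + α * (n.choose (k + 1) : ℝ)) = k ∧
    fracOf n (layerSum n k + α * (n.choose (k + 1) : ℝ)) = α ∧
    isoBound n (layerSum n k + α * (n.choose (k + 1) : ℝ)) =
      (1 - α) * (n.choose (k + 1) : ℝ) + α * (n.choose (k + 2) : ℝ) := by
  have hpos : (0 : ℝ) < (n.choose (k + 1) : ℝ) := by
    exact_mod_cast Nat.choose_pos (by omega)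
  have hlev : levelOf n (layerSum n k + α * (n.choose (k + 1) : ℝ)) = k := by
    unfold levelOf
    rw [Nat.findGreatest_eq_iff]
    refine ⟨hk.le, fun _ => by nlinarith, fun m hm _ h => ?_⟩
    have : (layerSum n (k + 1) : ℝ) ≤ layerSum n m := by exact_mod_cast layerSum_mono n hm
    rw [layerSum_succ] at this
    push_cast at this
    nlinarith
  have hfr : fracOf n (layerSum n k + α * (n.choose (k + 1) : ℝ)) = α := by
    unfold fracOf
    rw [hlev]
    field_simp
    ring
  refine ⟨hlev, hfr, ?_⟩
  unfold isoBound
  rw [hlev, hfr]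

/-- An `A`–`B` path in a graph `G`: a path that starts in `A`, ends in `B`, and has no interior
vertex in `A ∪ B`. -/
structure PathBetween {V : Type*} (G : SimpleGraph V) (A B : Set V) where
  first : V
  last : V
  walk : G.Walk first last
  isPath : walk.IsPath
  first_mem : first ∈ A
  last_mem : last ∈ B
  avoids : ∀ v ∈ walk.support, v ≠ first → v ≠ last → v ∉ A ∧ v ∉ B

/-- The set of interior vertices of an `A`–`B` path. -/
def PathBetween.interior {V : Type*} {G : SimpleGraph V} {A B : Set V}
    (p : PathBetween G A B) : Set V :=
  {v | v ∈ p.walk.support ∧ v ≠ p.first ∧ v ≠ p.last}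

/-! Edges from `A` to `B` are paths with empty interior, so they can all be used at once; only the
remaining paths, with non-empty interiors, compete for vertices. By a form of Menger's theorem
(`exists_disjoint_pathBetween`), `k` such paths exist as soon as, for every set `U` outside `A ∪ B`
with no edge to `B`, the boundary of `A ∪ U` has at least `k` vertices outside `B`. That form
follows from Hall's theorem: an injection that moves each free vertex to itself or a neighbour,
together with `k` tokens standing for "enter from `A`" and "leave into `B`", breaks into cycles, and
cutting them at the tokens gives the paths.

It remains to bound these boundaries plus the number of edges from `A` to `B`. Either `S = A ∪ U`
fills at most half of the cube, or the complement of `S` together with its boundary outside `B`,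
which contains `B`, does. In both cases vertex isoperimetry applies to the small side, and the part
of its boundary not counted among the separating vertices consists of ends of edges from `A` to `B`.

The isoperimetric inequality must serve all sizes between `|A|` and half of the cube. Here `b(x) =
harper n x - x`, where `harper n` interpolates the growth of Hamming balls. This difference
increases up to half of the cube in odd dimension, but not always in even dimension. Hence the
inequality is proved in the stronger form `2 * harper n (|𝒜| / 2)` for the cube of dimension `n +
1`, so that either dimension can be used according to parity. Its proof is an induction that splits
the cube in one direction and rests on the numerical inequality `harper_add_le`. -/

/-! ### The concave interpolation of Hamming ball sizes -/

/-- The number of sets of size less than `j` in an `n`-set, as a real number. -/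
noncomputable def ballSize (n j : ℕ) : ℝ := ∑ i ∈ Finset.range j, (n.choose i : ℝ)

/-- The line through the points `(ballSize n j, ballSize n (j + 1))` and
`(ballSize n (j + 1), ballSize n (j + 2))`. -/
noncomputable def harperLine (n j : ℕ) (x : ℝ) : ℝ :=
  ballSize n (j + 1) + (x - ballSize n j) * (((n : ℝ) - j) / (j + 1))

/-- The concave piecewise linear function which maps the size of each Hamming ball in the `n`-cube
to the size of the ball with the next radius. -/
noncomputable def harper (n : ℕ) (x : ℝ) : ℝ :=
  (Finset.range (n + 1)).inf' Finset.nonempty_range_add_one fun j => harperLine n j x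

theorem ballSize_zero (n : ℕ) : ballSize n 0 = 0 := by simp [ballSize]

theorem ballSize_succ (n j : ℕ) : ballSize n (j + 1) = ballSize n j + n.choose j := by
  simp [ballSize, Finset.sum_range_succ]

theorem ballSize_eq_layerSum (n k : ℕ) : ballSize n (k + 1) = layerSum n k := by
  simp [ballSize, layerSum]

theorem ballSize_succ_left (n j : ℕ) :
    ballSize (n + 1) (j + 1) = ballSize n (j + 1) + ballSize n j := by
  induction j with
  | zero => simp [ballSize]
  | succ j ih =>
    rw [ballSize_succ (n + 1), ih, ballSize_succ n (j + 1), ballSize_succ n j,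
      Nat.choose_succ_succ]
    push_cast
    ring

theorem ballSize_top (n : ℕ) : ballSize n (n + 1) = 2 ^ n := by
  have := Nat.sum_range_choose n
  unfold ballSize
  exact_mod_cast this

theorem ballSize_half (m : ℕ) : ballSize (2 * m + 1) (m + 1) = 4 ^ m := by
  have := Nat.sum_range_choose_halfway m
  unfold ballSize
  exact_mod_cast this

theorem choose_succ_eq_mul_slope (n j : ℕ) :
    ((n.choose (j + 1) : ℕ) : ℝ) = n.choose j * (((n : ℝ) - j) / (j + 1)) := by
  have hj : (j : ℝ) + 1 ≠ 0 := by positivity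
  rcases le_or_gt j n with h | h
  · have := Nat.choose_succ_right_eq n j
    have h2 : ((n.choose (j + 1) : ℕ) : ℝ) * (j + 1) = n.choose j * ((n : ℝ) - j) := by
      rw [← Nat.cast_sub h]
      exact_mod_cast this
    field_simp
    linarith
  · rw [Nat.choose_eq_zero_of_lt h, Nat.choose_eq_zero_of_lt (by omega)]
    simp

theorem slope_antitone (n : ℕ) {i j : ℕ} (h : i ≤ j) :
    ((n : ℝ) - j) / (j + 1) ≤ ((n : ℝ) - i) / (i + 1) := by
  have : (i : ℝ) ≤ j := by exact_mod_cast h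
  rw [div_le_div_iff₀ (by positivity) (by positivity)]
  have hn : (0 : ℝ) ≤ n := by positivity
  nlinarith

/-- The slopes decrease with the index, so the gap between line `l` and the point of index `j` grows
as `j` moves away from `l` on either side. This concavity is why the minimum of the lines is the
interpolation itself. -/
theorem ballSize_succ_le_harperLine (n l j : ℕ) :
    ballSize n (j + 1) ≤ harperLine n l (ballSize n j) := by
  have hstep : ∀ j, harperLine n l (ballSize n (j + 1)) - ballSize n (j + 2) =
      harperLine n l (ballSize n j) - ballSize n (j + 1) +
        n.choose j * (((n : ℝ) - l) / (l + 1) - ((n : ℝ) - j) / (j + 1)) := by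
    intro j
    have h1 := ballSize_succ n (j + 1)
    rw [choose_succ_eq_mul_slope] at h1
    have h2 := ballSize_succ n j
    unfold harperLine
    rw [h1]
    linear_combination (((n : ℝ) - l) / (l + 1)) * h2
  have h0 : harperLine n l (ballSize n l) = ballSize n (l + 1) := by simp [harperLine]
  rcases le_total l j with h | h
  · induction j, h using Nat.le_induction with
    | base => exact h0.ge
    | succ j hj ih =>
      have := hstep j
      have : (0 : ℝ) ≤ n.choose j * (((n : ℝ) - l) / (l + 1) - ((n : ℝ) - j) / (j + 1)) :=
        mul_nonneg (by positivity) (sub_nonneg.2 (slope_antitone n hj))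
      linarith
  · induction h using Nat.decreasingInduction with
    | self => exact h0.ge
    | of_succ j hj ih =>
      have := hstep j
      have : (n.choose j : ℝ) * (((n : ℝ) - l) / (l + 1) - ((n : ℝ) - j) / (j + 1)) ≤ 0 :=
        mul_nonpos_of_nonneg_of_nonpos (by positivity)
          (sub_nonpos.2 (slope_antitone n (by omega)))
      linarith

theorem harperLine_self (n j : ℕ) (α : ℝ) :
    harperLine n j (ballSize n j + α * n.choose j) =
      ballSize n (j + 1) + α * n.choose (j + 1) := by
  rw [choose_succ_eq_mul_slope, harperLine]
  ring

theorem harper_le_harperLine {n j : ℕ} (h : j ≤ n) (x : ℝ) : harper n x ≤ harperLine n j x :=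
  Finset.inf'_le _ (by simpa using Nat.lt_succ_of_le h)

theorem harper_apply {n j : ℕ} (h : j ≤ n) {α : ℝ} (h0 : 0 ≤ α) (h1 : α ≤ 1) :
    harper n (ballSize n j + α * n.choose j) = ballSize n (j + 1) + α * n.choose (j + 1) := by
  refine le_antisymm ((harper_le_harperLine h _).trans (harperLine_self n j α).le) ?_
  refine Finset.le_inf' _ _ fun l _ => ?_
  have h2 := ballSize_succ_le_harperLine n l j
  have h3 := ballSize_succ_le_harperLine n l (j + 1)
  have h4 := ballSize_succ n (j + 1)
  have h5 := ballSize_succ n j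
  have : harperLine n l (ballSize n j + α * n.choose j) =
      (1 - α) * harperLine n l (ballSize n j) + α * harperLine n l (ballSize n (j + 1)) := by
    unfold harperLine
    rw [h5]
    ring
  rw [this]
  have h6 := mul_le_mul_of_nonneg_left h2 (sub_nonneg.2 h1)
  have h7 := mul_le_mul_of_nonneg_left h3 h0
  rw [h4] at h7
  linarith

theorem exists_segment (n : ℕ) {m : ℕ} {x : ℝ} (h0 : 0 ≤ x) (hm : x ≤ ballSize n m)
    (hn : m ≤ n + 1) (hpos : 0 < m) :
    ∃ j < m, ∃ α : ℝ, 0 ≤ α ∧ α ≤ 1 ∧ x = ballSize n j + α * n.choose j := by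
  induction m with
  | zero => omega
  | succ m ih =>
    by_cases hx : x ≤ ballSize n m ∧ 0 < m
    · obtain ⟨j, hj, h⟩ := ih hx.1 (by omega) hx.2
      exact ⟨j, by omega, h⟩
    · have hlow : ballSize n m ≤ x := by
        rcases Nat.eq_zero_or_pos m with rfl | h
        · simpa [ballSize_zero] using h0
        · exact (not_le.1 fun h' => hx ⟨h', h⟩).le
      have hpos : (0 : ℝ) < n.choose m := by exact_mod_cast Nat.choose_pos (by omega)
      rw [ballSize_succ] at hm
      refine ⟨m, by omega, (x - ballSize n m) / n.choose m,
        div_nonneg (by linarith) hpos.le, ?_, ?_⟩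
      · rw [div_le_one hpos]; linarith
      · field_simp; ring

/-- In dimension `2m + 1` the segments `j ≤ m` cover exactly the sizes up to half of the cube, and
their slopes `(2m + 1 - j) / (j + 1)` are at least 1. The line through the point at `y` lies above
the function at `x`, so one slope suffices. -/
theorem harper_sub_self_mono (m : ℕ) {x y : ℝ} (hx : 0 ≤ x) (hxy : x ≤ y) (hy : y ≤ 4 ^ m) :
    harper (2 * m + 1) x - x ≤ harper (2 * m + 1) y - y := by
  obtain ⟨j, hj, α, h0, h1, rfl⟩ := exists_segment (2 * m + 1) (hx.trans hxy)
    (hy.trans (ballSize_half m).ge) (by omega) (by omega)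
  rw [harper_apply (by omega) h0 h1, ← harperLine_self]
  set y := ballSize (2 * m + 1) j + α * (2 * m + 1).choose j
  have h2 := harper_le_harperLine (n := 2 * m + 1) (j := j) (by omega) x
  have hjm : (j : ℝ) ≤ m := by exact_mod_cast Nat.lt_succ_iff.1 hj
  have h3 : (1 : ℝ) ≤ (((2 * m + 1 : ℕ) : ℝ) - j) / (j + 1) := by
    rw [le_div_iff₀ (by positivity)]
    push_cast
    linarith
  have h4 : harperLine (2 * m + 1) j y = harperLine (2 * m + 1) j x +
      (y - x) * ((((2 * m + 1 : ℕ) : ℝ) - j) / (j + 1)) := by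
    unfold harperLine
    ring
  nlinarith

theorem self_le_harper (n : ℕ) {x : ℝ} (h0 : 0 ≤ x) (h : x ≤ 2 ^ n) : x ≤ harper n x := by
  obtain ⟨j, hj, α, hα0, hα1, rfl⟩ := exists_segment n h0 (h.trans (ballSize_top n).ge) le_rfl
    (by omega)
  rw [harper_apply (by omega) hα0 hα1, ballSize_succ]
  have : (0 : ℝ) ≤ n.choose j := by positivity
  have : (0 : ℝ) ≤ n.choose (j + 1) := by positivity
  nlinarith

theorem harperLine_mono {n j : ℕ} (h : j ≤ n) : Monotone (harperLine n j) := by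
  intro x y hxy
  have : (0 : ℝ) ≤ ((n : ℝ) - j) / (j + 1) :=
    div_nonneg (sub_nonneg.2 (by exact_mod_cast h)) (by positivity)
  unfold harperLine
  nlinarith

/-! ### The numerical induction inequality -/

/-- The numerical inequality behind the induction on the dimension of the cube. -/
theorem harper_add_le (n : ℕ) {x y : ℝ} (hy : 0 ≤ y) (hyx : y ≤ x) (hx : x ≤ 2 ^ n) :
    harper (n + 1) (x + y) ≤ harper n x + max (harper n y) x := by
  obtain ⟨i, hi, β, hβ0, hβ1, hxe⟩ := exists_segment n (hy.trans hyx)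
    (hx.trans (ballSize_top n).ge) le_rfl (by omega)
  have htx : harper n x = ballSize n (i + 1) + β * n.choose (i + 1) := by
    rw [hxe, harper_apply (by omega) hβ0 hβ1]
  have hC : (0 : ℝ) ≤ n.choose (i + 1) := by positivity
  have hC' : (0 : ℝ) < n.choose i := by exact_mod_cast Nat.choose_pos (by omega)
  by_cases hyi : ballSize n i ≤ y
  · -- both numbers are in the segment `i`
    obtain ⟨γ, hγ⟩ : ∃ γ, y = ballSize n i + γ * n.choose i :=
      ⟨(y - ballSize n i) / n.choose i, by field_simp; ring⟩
    have hγ0 : 0 ≤ γ := by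
      by_contra! h
      nlinarith
    have hγβ : γ ≤ β := by
      by_contra! h
      nlinarith
    have hty : harper n y = ballSize n (i + 1) + γ * n.choose (i + 1) := by
      rw [hγ, harper_apply (by omega) hγ0 (hγβ.trans hβ1)]
    refine le_trans ?_ (add_le_add_right (le_max_left _ _) _)
    rw [htx, hty]
    have e0 := choose_succ_eq_mul_slope n i
    have hin : (i : ℝ) ≤ n := by exact_mod_cast Nat.lt_succ_iff.1 hi
    have e1 : (n.choose (i + 1) : ℝ) * (i + 1) = n.choose i * ((n : ℝ) - i) := by
      rw [e0]; field_simp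
    -- Since `ballSize (n + 1) (i + 1) = 2 * ballSize n i + n.choose i`, the sign of `β + γ - 1`
    -- decides in which segment to look for `x + y`.
    rcases le_total (β + γ) 1 with hδ | hδ
    · refine (harper_le_harperLine (j := i) (by omega) _).trans ?_
      -- Descending from the ball of index `i + 1` avoids a separate case `i = 0`.
      have hs : ballSize (n + 1) i = 2 * ballSize n i + n.choose i - (n + 1).choose i := by
        have h1 := ballSize_succ_left n i
        rw [ballSize_succ, ballSize_succ] at h1
        linarith
      have hc : ((n + 1).choose i : ℝ) * ((n : ℝ) + 1 - i) = n.choose i * (n + 1) := by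
        have := Nat.choose_mul_succ_eq n i
        have h2 : ((n + 1 - i : ℕ) : ℝ) = (n : ℝ) + 1 - i := by
          rw [Nat.cast_sub (by omega)]; push_cast; ring
        rw [← h2]
        exact_mod_cast this.symm
      unfold harperLine
      rw [ballSize_succ_left, ballSize_succ n i, hs, hxe, hγ]
      push_cast
      have h4 : (ballSize n i + β * n.choose i + (ballSize n i + γ * n.choose i) -
          (2 * ballSize n i + n.choose i - (n + 1).choose i)) *
            (((n : ℝ) + 1 - i) / (i + 1)) =
          n.choose i - (1 - (β + γ)) * (n.choose (i + 1) + n.choose i / (i + 1)) +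
            n.choose (i + 1) := by
        field_simp
        linear_combination hc - (β + γ) * e1
      rw [h4]
      have h5 : (0 : ℝ) ≤ (1 - (β + γ)) * (n.choose i / (i + 1)) :=
        mul_nonneg (by linarith) (by positivity)
      nlinarith
    · refine (harper_le_harperLine (j := i + 1) (by omega) _).trans ?_
      have h4 : (x + y - ballSize (n + 1) (i + 1)) * (((n + 1 : ℕ) - (i + 1 : ℕ) : ℝ) /
          ((i + 1 : ℕ) + 1)) ≤ (β + γ - 1) * n.choose (i + 1) := by
        rw [ballSize_succ_left, ballSize_succ n i, hxe, hγ]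
        push_cast
        have : (ballSize n i + β * n.choose i + (ballSize n i + γ * n.choose i) -
            (ballSize n i + n.choose i + ballSize n i)) * (((n : ℝ) + 1 - (i + 1)) / (i + 1 + 1)) =
            ((β + γ - 1) * n.choose (i + 1)) * ((i + 1) / (i + 2)) := by
          field_simp
          linear_combination (-(β + γ - 1) * (i + 2)) * e1
        rw [this]
        refine mul_le_of_le_one_right (mul_nonneg (by linarith) hC) ?_
        rw [div_le_one (by positivity)]
        linarith
      unfold harperLine
      rw [ballSize_succ_left, ballSize_succ n (i + 1)]
      linarith
  · obtain ⟨l, rfl⟩ : ∃ l, i = l + 1 := by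
      rcases i with _ | l
      · exact absurd (by simpa [ballSize_zero] using hy) hyi
      · exact ⟨l, rfl⟩
    have hCl : (0 : ℝ) < n.choose l := by exact_mod_cast Nat.choose_pos (by omega)
    refine (harper_le_harperLine (j := l + 1) (by omega) _).trans ?_
    have hs1 := ballSize_succ_left n l
    have hs2 := ballSize_succ_left n (l + 1)
    have hs3 := ballSize_succ n l
    -- Here `γ` may be negative: `y` can lie below the segment `l`. This only matters for `harper n
    -- y`, which is not needed when `γ ≤ β`.
    obtain ⟨γ, hγ⟩ : ∃ γ, y = ballSize n l + γ * n.choose l :=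
      ⟨(y - ballSize n l) / n.choose l, by field_simp; ring⟩
    rcases le_total γ β with h | h
    -- Raising `γ` to `β` puts the sum on the segment `l + 1` of the larger cube at parameter `β`,
    -- where Pascal's rule makes the line equal to `harper n x + x`.
    · refine le_trans (harperLine_mono (by omega) (?_ : x + y ≤ ballSize (n + 1) (l + 1) +
        β * (n + 1).choose (l + 1))) ?_
      · rw [hs1, hxe, hγ, Nat.choose_succ_succ]
        push_cast
        nlinarith
      · refine le_trans ?_ (add_le_add_right (le_max_right _ _) _)
        rw [harperLine_self, htx, hs2, hxe, Nat.choose_succ_succ]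
        push_cast
        linarith
    · have hγ1 : γ ≤ 1 := by
        by_contra! h'
        nlinarith
      have hty : harper n y = ballSize n (l + 1) + γ * n.choose (l + 1) := by
        rw [hγ, harper_apply (by omega) (hβ0.trans h) hγ1]
      refine le_trans ?_ (add_le_add_right (le_max_left _ _) _)
      rw [htx, hty]
      have e1 : (n.choose (l + 1) : ℝ) * (l + 1) = n.choose l * ((n : ℝ) - l) := by
        rw [choose_succ_eq_mul_slope n l]; field_simp
      have e2 : (n.choose (l + 2) : ℝ) * (l + 2) = n.choose (l + 1) * ((n : ℝ) - l - 1) := by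
        rw [choose_succ_eq_mul_slope n (l + 1)]; push_cast; field_simp; ring
      unfold harperLine
      rw [hs1, hs2, hxe, hγ]
      push_cast
      have : (ballSize n (l + 1) + β * n.choose (l + 1) + (ballSize n l + γ * n.choose l) -
          (ballSize n (l + 1) + ballSize n l)) * (((n : ℝ) + 1 - (l + 1)) / (l + 1 + 1)) =
          β * n.choose (l + 2) + γ * n.choose (l + 1) -
            (γ - β) * (n.choose (l + 1) / (l + 2)) := by
        field_simp
        linear_combination (-γ * (l + 2)) * e1 - β * (l + 2) * e2
      rw [this]
      have : 0 ≤ (γ - β) * ((n.choose (l + 1) : ℝ) / (l + 2)) :=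
        mul_nonneg (by linarith) (by positivity)
      linarith

/-- The diagonal case of `harper_add_le`; it shows that the halved form of the isoperimetric bound
is at least as strong as the plain one. -/
theorem harper_succ_le (n : ℕ) {x : ℝ} (h0 : 0 ≤ x) (h : x ≤ 2 ^ (n + 1)) :
    harper (n + 1) x ≤ 2 * harper n (x / 2) := by
  have hx : x / 2 ≤ 2 ^ n := by rw [pow_succ] at h; linarith
  have h1 := harper_add_le n (by linarith : 0 ≤ x / 2) le_rfl hx
  rw [add_halves, max_eq_left (self_le_harper n (by linarith) hx)] at h1
  linarith

theorem harper_half (n : ℕ) : harper n (1 / 2) = 1 + n / 2 := by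
  have := harper_apply (Nat.zero_le n) (α := 1 / 2) (by norm_num) (by norm_num)
  simp only [ballSize_zero, ballSize_succ, Nat.choose_zero_right, Nat.cast_one, mul_one,
    zero_add, Nat.choose_one_right] at this
  rw [this]
  ring

theorem harper_zero_right (n : ℕ) : harper n 0 = 1 := by
  have := harper_apply (Nat.zero_le n) (α := 0) le_rfl (by norm_num)
  simpa [ballSize_zero, ballSize_succ] using this

theorem harper_zero_left_le (x : ℝ) : harper 0 x ≤ 1 := by
  refine (harper_le_harperLine le_rfl x).trans ?_
  simp [harperLine, ballSize_zero, ballSize_succ]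

theorem isoBound_eq_harper (n : ℕ) (x : ℝ) (h1 : 1 ≤ x) (h2 : x < 2 ^ n) :
    isoBound n x = harper n x - x := by
  obtain ⟨k, hk, α, hα0, hα1, rfl⟩ := exists_level n x h1 h2
  rw [(isoBound_eq n k hk α hα0 hα1).2.2, ← ballSize_eq_layerSum, harper_apply hk hα0 hα1.le,
    ballSize_succ n (k + 1)]
  ring

/-- The induction step for cardinalities: `a` and `b` are the sizes of the two sections, `p` and `q`
those of their neighbourhoods. An empty smaller section is special, since it has no neighbourhood
although `harper n 0 = 1`. For `a ≥ 2` the term `a / 2` attains the maximum anyway; `a = 1` is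
computed directly. -/
theorem two_mul_harper_succ_le {n a b p q : ℕ} (hba : b ≤ a) (ha : 0 < a) (ha' : a ≤ 2 ^ (n + 1))
    (hp : 2 * harper n ((a : ℝ) / 2) ≤ p) (hq : 0 < b → 2 * harper n ((b : ℝ) / 2) ≤ q) :
    2 * harper (n + 1) (((a + b : ℕ) : ℝ) / 2) ≤ p + max (q : ℝ) a := by
  have hx : (a : ℝ) / 2 ≤ 2 ^ n := by
    have : (a : ℝ) ≤ 2 ^ (n + 1) := by exact_mod_cast ha'
    rw [pow_succ] at this
    linarith
  have hb : (b : ℝ) ≤ a := by exact_mod_cast hba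
  have h := harper_add_le n (by positivity : (0 : ℝ) ≤ b / 2) (by linarith) hx
  have hle := le_max_right (q : ℝ) a
  push_cast
  rw [add_div]
  rcases Nat.eq_zero_or_pos b with rfl | hb0
  · rcases (show a = 1 ∨ 2 ≤ a by omega) with rfl | ha2
    · have e : ((1 : ℕ) : ℝ) / 2 + ((0 : ℕ) : ℝ) / 2 = 1 / 2 := by norm_num
      rw [e, harper_half]
      rw [Nat.cast_one, harper_half] at hp
      push_cast at hle ⊢
      linarith
    · have ha2' : (2 : ℝ) ≤ a := by exact_mod_cast ha2
      have e : ((0 : ℕ) : ℝ) / 2 = 0 := by norm_num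
      rw [e] at h ⊢
      rw [harper_zero_right, max_eq_right (by linarith)] at h
      linarith
  · have h1 := hq hb0
    have h2 := le_max_left (q : ℝ) a
    rcases le_total (harper n ((b : ℝ) / 2)) (a / 2) with h3 | h3
    · rw [max_eq_right h3] at h
      linarith
    · rw [max_eq_left h3] at h
      linarith

/-! ### Vertex isoperimetry by splitting the cube -/

section ClosedNbhd

variable {α : Type*} [DecidableEq α]

/-- The sets which are in the family `𝒜` or arise from a member of `𝒜` by adding or removing one
element of `s`. -/
def closedNbhd (s : Finset α) (𝒜 : Finset (Finset α)) : Finset (Finset α) :=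
  𝒜 ∪ s.biUnion fun i => 𝒜.image fun C => symmDiff C {i}

theorem mem_closedNbhd {s : Finset α} {𝒜 : Finset (Finset α)} {D : Finset α} :
    D ∈ closedNbhd s 𝒜 ↔ D ∈ 𝒜 ∨ ∃ i ∈ s, ∃ C ∈ 𝒜, symmDiff C {i} = D := by
  simp [closedNbhd]

theorem symmDiff_singleton_of_notMem {a : α} {C : Finset α} (h : a ∉ C) :
    symmDiff C {a} = insert a C := by
  ext x
  simp only [Finset.mem_symmDiff, Finset.mem_singleton, Finset.mem_insert]
  by_cases hx : x = a
  · subst hx; simp [h]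
  · simp [hx]

theorem symmDiff_singleton_insert {a : α} {C : Finset α} (h : a ∉ C) :
    symmDiff (insert a C) {a} = C := by
  rw [← symmDiff_singleton_of_notMem h, symmDiff_symmDiff_cancel_right]

theorem symmDiff_singleton_insert_of_ne {a i : α} (C : Finset α) (h : i ≠ a) :
    symmDiff (insert a C) {i} = insert a (symmDiff C {i}) := by
  ext x
  simp only [Finset.mem_symmDiff, Finset.mem_singleton, Finset.mem_insert]
  by_cases hx : x = a
  · subst hx; simp [h.symm]
  · simp [hx]

theorem notMem_symmDiff_singleton {a i : α} {C : Finset α} (hC : a ∉ C) (h : i ≠ a) :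
    a ∉ symmDiff C {i} := by
  simp [Finset.mem_symmDiff, hC, h.symm]

/-- Changing an element of `s` keeps a set in its section, while changing `a` carries one section
onto the other. -/
theorem closedNbhd_nonMemberSubfamily_subset {a : α} {s : Finset α} (ha : a ∉ s)
    (𝒜 : Finset (Finset α)) :
    closedNbhd s (𝒜.nonMemberSubfamily a) ∪ 𝒜.memberSubfamily a ⊆
      (closedNbhd (insert a s) 𝒜).nonMemberSubfamily a := by
  intro D hD
  rw [Finset.mem_nonMemberSubfamily, mem_closedNbhd]
  rcases Finset.mem_union.1 hD with hD | hD
  · rcases mem_closedNbhd.1 hD with hD | ⟨i, hi, C, hC, rfl⟩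
    · rw [Finset.mem_nonMemberSubfamily] at hD
      exact ⟨Or.inl hD.1, hD.2⟩
    · rw [Finset.mem_nonMemberSubfamily] at hC
      have hia : i ≠ a := fun h => ha (h ▸ hi)
      exact ⟨Or.inr ⟨i, Finset.mem_insert_of_mem hi, C, hC.1, rfl⟩,
        notMem_symmDiff_singleton hC.2 hia⟩
  · rw [Finset.mem_memberSubfamily] at hD
    exact ⟨Or.inr ⟨a, Finset.mem_insert_self _ _, _, hD.1, symmDiff_singleton_insert hD.2⟩, hD.2⟩

theorem closedNbhd_memberSubfamily_subset {a : α} {s : Finset α} (ha : a ∉ s)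
    (𝒜 : Finset (Finset α)) :
    closedNbhd s (𝒜.memberSubfamily a) ∪ 𝒜.nonMemberSubfamily a ⊆
      (closedNbhd (insert a s) 𝒜).memberSubfamily a := by
  intro D hD
  rw [Finset.mem_memberSubfamily, mem_closedNbhd]
  rcases Finset.mem_union.1 hD with hD | hD
  · rcases mem_closedNbhd.1 hD with hD | ⟨i, hi, C, hC, rfl⟩
    · rw [Finset.mem_memberSubfamily] at hD
      exact ⟨Or.inl hD.1, hD.2⟩
    · rw [Finset.mem_memberSubfamily] at hC
      have hia : i ≠ a := fun h => ha (h ▸ hi)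
      exact ⟨Or.inr ⟨i, Finset.mem_insert_of_mem hi, _, hC.1,
        symmDiff_singleton_insert_of_ne C hia⟩, notMem_symmDiff_singleton hC.2 hia⟩
  · rw [Finset.mem_nonMemberSubfamily] at hD
    exact ⟨Or.inr ⟨a, Finset.mem_insert_self _ _, _, hD.1, symmDiff_singleton_of_notMem hD.2⟩, hD.2⟩

/-- A vertex isoperimetric inequality in the cube: a piecewise linear form of Harper's theorem. -/
theorem two_mul_harper_le_card_closedNbhd (n : ℕ) (s : Finset α) (hs : s.card = n + 1)
    (𝒜 : Finset (Finset α)) (h𝒜 : 𝒜 ⊆ s.powerset) (hne : 𝒜.Nonempty) :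
    2 * harper n ((𝒜.card : ℝ) / 2) ≤ (closedNbhd s 𝒜).card := by
  induction n generalizing s 𝒜 with
  | zero =>
    obtain ⟨a, ha⟩ := Finset.card_pos.1 (by omega : 0 < s.card)
    obtain ⟨C, hC⟩ := hne
    have h2 : 2 ≤ (closedNbhd s 𝒜).card := by
      have hCC : C ≠ symmDiff C {a} := fun h => by
        have := symmDiff_eq_left.1 h.symm
        simp at this
      rw [← Finset.card_pair hCC]
      refine Finset.card_le_card fun D hD => mem_closedNbhd.2 ?_
      rcases Finset.mem_insert.1 hD with rfl | hD
      · exact Or.inl hC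
      · exact Or.inr ⟨a, ha, C, hC, (Finset.mem_singleton.1 hD).symm⟩
    have h2' : (2 : ℝ) ≤ (closedNbhd s 𝒜).card := by exact_mod_cast h2
    have := harper_zero_left_le ((𝒜.card : ℝ) / 2)
    linarith
  | succ n ih =>
    obtain ⟨a, s, ha, rfl, hs'⟩ := Finset.card_eq_succ.1 hs
    have h0 : 𝒜.nonMemberSubfamily a ⊆ s.powerset := fun C hC => by
      rw [Finset.mem_nonMemberSubfamily] at hC
      have := Finset.mem_powerset.1 (h𝒜 hC.1)
      rwa [Finset.mem_powerset, ← Finset.subset_insert_iff_of_notMem hC.2]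
    have h1 : 𝒜.memberSubfamily a ⊆ s.powerset := fun C hC => by
      rw [Finset.mem_memberSubfamily] at hC
      have := (Finset.subset_insert _ _).trans (Finset.mem_powerset.1 (h𝒜 hC.1))
      rwa [Finset.mem_powerset, ← Finset.subset_insert_iff_of_notMem hC.2]
    have hc0 := Finset.card_le_card (closedNbhd_nonMemberSubfamily_subset ha 𝒜)
    have hc1 := Finset.card_le_card (closedNbhd_memberSubfamily_subset ha 𝒜)
    have hT := Finset.card_memberSubfamily_add_card_nonMemberSubfamily a
      (closedNbhd (insert a s) 𝒜)
    have hA := Finset.card_memberSubfamily_add_card_nonMemberSubfamily a 𝒜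
    have key : ∀ 𝒞 𝒟 : Finset (Finset α), 𝒞 ⊆ s.powerset → 𝒟 ⊆ s.powerset →
        𝒟.card ≤ 𝒞.card → 𝒞.card + 𝒟.card = 𝒜.card →
        (closedNbhd s 𝒞 ∪ 𝒟).card + (closedNbhd s 𝒟 ∪ 𝒞).card ≤
          (closedNbhd (insert a s) 𝒜).card →
        2 * harper (n + 1) ((𝒜.card : ℝ) / 2) ≤ (closedNbhd (insert a s) 𝒜).card := by
      intro 𝒞 𝒟 h𝒞 h𝒟 hle hsum hcard
      have hpos : 0 < 𝒞.card := by
        have := Finset.card_pos.2 hne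
        omega
      have hmax : 𝒞.card ≤ 2 ^ (n + 1) := by
        rw [← hs', ← Finset.card_powerset]
        exact Finset.card_le_card h𝒞
      have := two_mul_harper_succ_le (p := (closedNbhd s 𝒞).card) (q := (closedNbhd s 𝒟).card)
        hle hpos hmax (ih s hs' 𝒞 h𝒞 (Finset.card_pos.1 hpos))
        fun h => ih s hs' 𝒟 h𝒟 (Finset.card_pos.1 h)
      rw [hsum] at this
      refine this.trans ?_
      have e1 := Finset.card_le_card
        (Finset.subset_union_left : closedNbhd s 𝒞 ⊆ closedNbhd s 𝒞 ∪ 𝒟)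
      have e2 := Finset.card_le_card
        (Finset.subset_union_left : closedNbhd s 𝒟 ⊆ closedNbhd s 𝒟 ∪ 𝒞)
      have e3 := Finset.card_le_card
        (Finset.subset_union_right : 𝒞 ⊆ closedNbhd s 𝒟 ∪ 𝒞)
      have : (closedNbhd s 𝒞).card + max (closedNbhd s 𝒟).card 𝒞.card ≤
          (closedNbhd (insert a s) 𝒜).card := by
        have := max_le e2 e3
        omega
      exact_mod_cast this
    rcases le_total (𝒜.memberSubfamily a).card (𝒜.nonMemberSubfamily a).card with h | h
    · exact key _ _ h0 h1 h (by omega) (by omega)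
    · exact key _ _ h1 h0 h (by omega) (by omega)

end ClosedNbhd

/-! ### Outer boundaries of sets up to half of the cube -/

open Classical in
/-- The vertices outside `A` with a neighbour in `A`. -/
noncomputable def outerNbhd {V : Type*} [Fintype V] (G : SimpleGraph V) (A : Finset V) :
    Finset V :=
  Finset.univ.filter fun v => v ∉ A ∧ ∃ u ∈ A, G.Adj u v

theorem mem_outerNbhd {V : Type*} [Fintype V] {G : SimpleGraph V} {A : Finset V} {v : V} :
    v ∈ outerNbhd G A ↔ v ∉ A ∧ ∃ u ∈ A, G.Adj u v := by
  simp [outerNbhd]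

theorem card_closedNbhd_univ_le (n : ℕ) (A : Finset (Finset (Fin n))) :
    (closedNbhd Finset.univ A).card ≤ A.card + (outerNbhd (cube n) A).card := by
  classical
  refine (Finset.card_le_card fun D hD => ?_).trans (Finset.card_union_le _ _)
  by_cases h : D ∈ A
  · exact Finset.mem_union_left _ h
  · obtain ⟨i, -, C, hC, rfl⟩ := (mem_closedNbhd.1 hD).resolve_left h
    refine Finset.mem_union_right _ (mem_outerNbhd.2 ⟨h, C, hC, ?_⟩)
    change (symmDiff C (symmDiff C {i})).card = 1
    rw [symmDiff_symmDiff_cancel_left, Finset.card_singleton]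

/-- Sets of at most half of the vertices have outer neighbourhoods at least as large as `isoBound`
predicts for any smaller size. -/
theorem isoBound_le_card_outerNbhd {n : ℕ} {A : Finset (Finset (Fin n))} {x : ℝ} (h1 : 1 ≤ x)
    (hx : x ≤ A.card) (hA : 2 * A.card ≤ 2 ^ n) :
    isoBound n x ≤ (outerNbhd (cube n) A).card := by
  have hA' : 2 * (A.card : ℝ) ≤ 2 ^ n := by exact_mod_cast hA
  have hpos : (0 : ℝ) < A.card := by linarith
  rw [isoBound_eq_harper n x h1 (by linarith)]
  have hne : A.Nonempty := Finset.card_pos.1 (by exact_mod_cast hpos)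
  obtain ⟨N, rfl⟩ : ∃ N, n = N + 1 := by
    rcases n with _ | N
    · have := Finset.card_pos.2 hne
      simp only [pow_zero] at hA
      omega
    · exact ⟨N, rfl⟩
  have hT := two_mul_harper_le_card_closedNbhd N Finset.univ (by simp) A (by simp) hne
  have hc : ((closedNbhd Finset.univ A).card : ℝ) ≤ A.card + (outerNbhd (cube (N + 1)) A).card := by
    exact_mod_cast card_closedNbhd_univ_le (N + 1) A
  -- Monotonicity is available in odd dimension only. If the cube has odd dimension `N + 1`, pass
  -- from the halved form to `harper (N + 1)` at `A.card` and then descend to `x`; if `N` is odd,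
  -- descend from `A.card / 2` to `x / 2` first and pass to `harper (N + 1)` at `x`.
  rcases Nat.even_or_odd' N with ⟨m, rfl | rfl⟩
  · have h4 : (2 : ℝ) ^ (2 * m + 1) = 2 * 4 ^ m := by
      rw [pow_succ, pow_mul]; norm_num; ring
    have e := harper_sub_self_mono m (by linarith : 0 ≤ x) hx (by linarith)
    have e2 := harper_succ_le (2 * m) hpos.le (by linarith)
    linarith
  · have h4 : (2 : ℝ) ^ (2 * m + 1 + 1) = 4 * 4 ^ m := by
      rw [pow_succ, pow_succ, pow_mul]; norm_num; ring
    have e := harper_sub_self_mono m (by linarith : 0 ≤ x / 2) (by linarith : x / 2 ≤ A.card / 2)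
      (by linarith)
    have e2 := harper_succ_le (2 * m + 1) (by linarith : 0 ≤ x) (by linarith)
    linarith

/-! ### Menger's theorem from Hall's theorem -/

section DisjointPaths

variable {V : Type*} {G : SimpleGraph V}

theorem exists_walk_of_seq (g : ℕ → V) (N : ℕ) (h : ∀ j < N, G.Adj (g j) (g (j + 1))) :
    ∃ p : G.Walk (g 0) (g N), p.support = (List.range (N + 1)).map g := by
  induction N with
  | zero => exact ⟨.nil, by simp⟩
  | succ N ih =>
    obtain ⟨p, hp⟩ := ih fun j hj => h j (by omega)
    refine ⟨p.concat (h N (by omega)), ?_⟩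
    rw [SimpleGraph.Walk.support_concat, hp, List.range_succ (n := N + 1)]
    simp

theorem exists_pathBetween_of_seq {A B : Set V} (hAB : Disjoint A B) (w : ℕ → V) (m : ℕ)
    (hadj : ∀ j < m, G.Adj (w j) (w (j + 1))) (hinj : Set.InjOn w (Set.Iic m))
    (hout : ∀ j ≤ m, w j ∉ A ∧ w j ∉ B) (hA : ∃ a ∈ A, G.Adj a (w 0))
    (hB : ∃ b ∈ B, G.Adj (w m) b) :
    ∃ P : PathBetween G A B, P.interior = w '' Set.Iic m := by
  obtain ⟨a, haA, ha⟩ := hA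
  obtain ⟨b, hbB, hb⟩ := hB
  obtain ⟨p, hp⟩ := exists_walk_of_seq w m hadj
  have hmem : ∀ v, v ∈ p.support ↔ ∃ j ≤ m, w j = v := fun v => by
    simp [hp]
  have hab : a ≠ b := fun h => Set.disjoint_left.1 hAB haA (h ▸ hbB)
  have hsupp : ∀ v, v ∈ (SimpleGraph.Walk.cons ha (p.concat hb)).support ↔
      v = a ∨ (∃ j ≤ m, w j = v) ∨ v = b := fun v => by
    simp [SimpleGraph.Walk.support_concat, hmem]
  refine ⟨⟨a, b, .cons ha (p.concat hb), ?_, haA, hbB, ?_⟩, ?_⟩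
  · rw [SimpleGraph.Walk.isPath_def, SimpleGraph.Walk.support_cons,
      SimpleGraph.Walk.support_concat, List.nodup_cons]
    constructor
    · simp only [List.mem_append, List.mem_singleton, hmem]
      rintro (⟨j, hj, rfl⟩ | h)
      · exact (hout j hj).1 haA
      · exact hab h
    · rw [List.nodup_append]
      refine ⟨?_, by simp, ?_⟩
      · rw [hp]
        refine List.Nodup.map_on ?_ List.nodup_range
        intro i hi j hj hij
        exact hinj (by simpa [Nat.lt_succ_iff] using hi) (by simpa [Nat.lt_succ_iff] using hj) hij
      · intro v hv u hu
        obtain ⟨j, hj, rfl⟩ := (hmem v).1 hv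
        rintro rfl
        rw [List.mem_singleton] at hu
        exact (hout j hj).2 (hu ▸ hbB)
  · intro v hv hva hvb
    obtain h | ⟨j, hj, rfl⟩ | h := (hsupp v).1 hv
    · exact absurd h hva
    · exact hout j hj
    · exact absurd h hvb
  · ext v
    simp only [PathBetween.interior, Set.mem_ofPred_eq, hsupp, Set.mem_image, Set.mem_Iic]
    constructor
    · rintro ⟨h | h | h, hva, hvb⟩
      · exact absurd h hva
      · exact h
      · exact absurd h hvb
    · rintro ⟨j, hj, rfl⟩
      exact ⟨Or.inr (Or.inl ⟨j, hj, rfl⟩), fun h => (hout j hj).1 (h ▸ haA),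
        fun h => (hout j hj).2 (h ▸ hbB)⟩

/-- First return times of an injection of a finite set to a subset. -/
theorem exists_return_time {W ι : Type*} [Finite W] [Finite ι] {f : W ⊕ ι → W ⊕ ι}
    (hf : Function.Injective f) (i : ι) :
    ∃ r, 0 < r ∧ (∃ i', f^[r] (Sum.inr i) = Sum.inr i') ∧
      ∀ j, 0 < j → j < r → ∃ w, f^[j] (Sum.inr i) = Sum.inl w := by
  classical
  have hex : ∃ r, 0 < r ∧ ∃ i', f^[r] (Sum.inr i) = Sum.inr i' := by
    -- An injective self-map of a finite set has only periodic points.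
    obtain ⟨r, hr, h⟩ := hf.mem_periodicPts (Sum.inr i)
    exact ⟨r, hr, i, h⟩
  refine ⟨Nat.find hex, (Nat.find_spec hex).1, (Nat.find_spec hex).2, fun j hj hlt => ?_⟩
  rcases h : f^[j] (Sum.inr i) with w | i'
  · exact ⟨w, rfl⟩
  · exact absurd ⟨hj, i', h⟩ (Nat.find_min hex hlt)

/-- Cancelling the common iterates by injectivity leaves a token equal to an iterate of a token
before its return time; such an iterate lies in `W` unless its time is 0. -/
theorem iterate_eq_of_lt_return_time {W ι : Type*} {f : W ⊕ ι → W ⊕ ι}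
    (hf : Function.Injective f) {r : ι → ℕ}
    (hr : ∀ i j, 0 < j → j < r i → ∃ w, f^[j] (Sum.inr i) = Sum.inl w) {i i' : ι} {j j' : ℕ}
    (hj : j < r i) (hj' : j' < r i') (h : f^[j] (Sum.inr i) = f^[j'] (Sum.inr i')) :
    i = i' ∧ j = j' := by
  wlog hle : j ≤ j' generalizing i i' j j'
  · obtain ⟨h1, h2⟩ := this hj' hj h.symm (by omega)
    exact ⟨h1.symm, h2.symm⟩
  obtain ⟨d, rfl⟩ := Nat.exists_eq_add_of_le hle
  rw [Function.iterate_add_apply] at h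
  have h' := hf.iterate j h
  rcases Nat.eq_zero_or_pos d with rfl | hd
  · exact ⟨Sum.inr_injective h', rfl⟩
  · obtain ⟨w, hw⟩ := hr i' d hd (by omega)
    rw [hw] at h'
    simp at h'

/-- A version of Menger's theorem. -/
theorem exists_disjoint_pathBetween [Fintype V] [DecidableEq V] {A B : Finset V}
    (hA : A.Nonempty) (hAB : Disjoint A B) (k : ℕ)
    (hk : ∀ U : Finset V, Disjoint U A → Disjoint U B → (∀ u ∈ U, ∀ b ∈ B, ¬ G.Adj u b) →
      k ≤ (outerNbhd G (A ∪ U) \ B).card) :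
    ∃ P : Fin k → PathBetween G (A : Set V) (B : Set V),
      (∀ i, (P i).interior.Nonempty) ∧
        ∀ i j, i ≠ j → Disjoint (P i).interior (P j).interior := by
  classical
  let W := {v : V // v ∉ A ∧ v ∉ B}
  -- Each token is both a start in `A` and an end in `B`. A vertex may stay put, which means that no
  -- path uses it; a token may not go to a token, which forces non-empty interiors.
  let R : W ⊕ Fin k → W ⊕ Fin k → Prop := fun x y => match x, y with
    | .inl w, .inl w' => w' = w ∨ G.Adj w w'
    | .inl w, .inr _ => ∃ b ∈ B, G.Adj w b
    | .inr _, .inl w => ∃ a ∈ A, G.Adj a w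
    | .inr _, .inr _ => False
  have hall : ∀ S : Finset (W ⊕ Fin k),
      S.card ≤ (Finset.univ.filter fun y => ∃ x ∈ S, R x y).card := by
    intro S
    set M := Finset.univ.filter fun y => ∃ x ∈ S, R x y with hM
    have hmemM : ∀ y, y ∈ M ↔ ∃ x ∈ S, R x y := fun y => by simp [hM]
    rw [← S.card_toLeft_add_card_toRight, ← M.card_toLeft_add_card_toRight]
    have hSM : S.toLeft ⊆ M.toLeft := fun w hw => by
      rw [Finset.mem_toLeft] at hw ⊢
      exact (hmemM _).2 ⟨_, hw, Or.inl rfl⟩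
    have hSk : S.toRight.card ≤ k := by simpa using Finset.card_le_univ S.toRight
    rcases S.toRight.eq_empty_or_nonempty with h0 | ⟨i, hi⟩
    · have := Finset.card_le_card hSM
      rw [h0, Finset.card_empty]
      omega
    rw [Finset.mem_toRight] at hi
    -- If some vertex of `S` reaches `B`, all tokens are available as images. Otherwise the vertices
    -- of `S` form an admissible `U`, and its boundary supplies `k` images beyond `U` itself, enough
    -- for the tokens in `S`.
    by_cases hY : ∃ w ∈ S.toLeft, ∃ b ∈ B, G.Adj w b
    · obtain ⟨w, hw, hwb⟩ := hY
      rw [Finset.mem_toLeft] at hw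
      have : M.toRight = Finset.univ := Finset.eq_univ_of_forall fun i' => by
        rw [Finset.mem_toRight]
        exact (hmemM _).2 ⟨_, hw, hwb⟩
      have := Finset.card_le_card hSM
      simp_all
      omega
    · push Not at hY
      let U : Finset V := S.toLeft.map (Function.Embedding.subtype _)
      have hU : ∀ v, v ∈ U ↔ ∃ h : v ∉ A ∧ v ∉ B, Sum.inl ⟨v, h⟩ ∈ S := fun v => by
        simp only [U, Finset.mem_map, Finset.mem_toLeft, Function.Embedding.subtype_apply]
        constructor
        · rintro ⟨w, hw, rfl⟩
          exact ⟨w.2, hw⟩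
        · rintro ⟨h, hv⟩
          exact ⟨⟨v, h⟩, hv, rfl⟩
      have h1 := hk U (Finset.disjoint_left.2 fun v hv => ((hU v).1 hv).1.1)
        (Finset.disjoint_left.2 fun v hv => ((hU v).1 hv).1.2) fun u hu b hb => by
          obtain ⟨h, hv⟩ := (hU u).1 hu
          exact hY ⟨u, h⟩ (Finset.mem_toLeft.2 hv) b hb
      have hsub : U ∪ (outerNbhd G (A ∪ U) \ B) ⊆ M.toLeft.map (Function.Embedding.subtype _) := by
        intro v hv
        have hmem : ∀ h : v ∉ A ∧ v ∉ B, Sum.inl ⟨v, h⟩ ∈ M →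
            v ∈ M.toLeft.map (Function.Embedding.subtype _) := fun h hvM =>
          Finset.mem_map.2 ⟨⟨v, h⟩, Finset.mem_toLeft.2 hvM, rfl⟩
        rcases Finset.mem_union.1 hv with hv | hv
        · obtain ⟨h, hvS⟩ := (hU v).1 hv
          exact hmem h ((hmemM _).2 ⟨_, hvS, Or.inl rfl⟩)
        · obtain ⟨hv, hvB⟩ := Finset.mem_sdiff.1 hv
          obtain ⟨hvAU, u, hu, huv⟩ := mem_outerNbhd.1 hv
          have hvA : v ∉ A := fun h => hvAU (Finset.mem_union_left _ h)
          refine hmem ⟨hvA, hvB⟩ ((hmemM _).2 ?_)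
          rcases Finset.mem_union.1 hu with hu | hu
          · exact ⟨_, hi, u, hu, huv⟩
          · obtain ⟨h, huS⟩ := (hU u).1 hu
            exact ⟨_, huS, Or.inr huv⟩
      have h2 := Finset.card_le_card hsub
      rw [Finset.card_map, Finset.card_union_of_disjoint] at h2
      · have : U.card = S.toLeft.card := Finset.card_map _
        omega
      · refine Finset.disjoint_left.2 fun v hv hv' => ?_
        exact (mem_outerNbhd.1 (Finset.mem_sdiff.1 hv').1).1 (Finset.mem_union_right _ hv)
  obtain ⟨f, hf, hfR⟩ := (Fintype.all_card_le_filter_rel_iff_exists_injective R).1 hall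
  choose r hr0 hr1 hr2 using fun i => exists_return_time hf i
  have hr : ∀ i, 2 ≤ r i := by
    intro i
    by_contra! h
    have h1 : r i = 1 := by have := hr0 i; omega
    obtain ⟨i', hi'⟩ := hr1 i
    rw [h1, Function.iterate_one] at hi'
    have := hfR (Sum.inr i)
    rw [hi'] at this
    exact this
  choose w hw using fun i j (h : 0 < j ∧ j < r i) => hr2 i j h.1 h.2
  let v : Fin k → ℕ → V := fun i j =>
    if h : 0 < j + 1 ∧ j + 1 < r i then (w i (j + 1) h : V) else hA.choose
  have hv : ∀ i j, j ≤ r i - 2 →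
      ∃ w : W, f^[j + 1] (Sum.inr i) = Sum.inl w ∧ v i j = w := by
    intro i j hj
    have h : 0 < j + 1 ∧ j + 1 < r i := by have := hr i; omega
    exact ⟨_, hw i _ h, by simp only [v, dif_pos h]⟩
  have hinj : ∀ i i' j j', j ≤ r i - 2 → j' ≤ r i' - 2 → v i j = v i' j' → i = i' ∧ j = j' := by
    intro i i' j j' hj hj' h
    obtain ⟨w1, hw1, e1⟩ := hv i j hj
    obtain ⟨w2, hw2, e2⟩ := hv i' j' hj'
    have : w1 = w2 := Subtype.ext (by rw [← e1, ← e2, h])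
    have h1 := hr i
    have h2 := hr i'
    have := iterate_eq_of_lt_return_time hf hr2 (by omega : j + 1 < r i)
      (by omega : j' + 1 < r i') (by rw [hw1, hw2, this])
    omega
  have hpath : ∀ i, ∃ P : PathBetween G (A : Set V) (B : Set V),
      P.interior = v i '' Set.Iic (r i - 2) := by
    intro i
    refine exists_pathBetween_of_seq (by exact_mod_cast hAB) (v i) (r i - 2) ?_ ?_ ?_ ?_ ?_
    · intro j hj
      obtain ⟨w1, hw1, e1⟩ := hv i j hj.le
      obtain ⟨w2, hw2, e2⟩ := hv i (j + 1) hj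
      have h := hfR (f^[j + 1] (Sum.inr i))
      rw [← Function.iterate_succ_apply' f, hw2, hw1] at h
      -- Staying put is impossible here, because the vertices visited before the return are
      -- distinct.
      rcases h with h | h
      · have := (hinj i i j (j + 1) hj.le hj (by rw [e1, e2, h])).2
        omega
      · rw [e1, e2]
        exact h
    · intro j hj j' hj' h
      exact (hinj i i j j' hj hj' h).2
    · intro j hj
      obtain ⟨w1, -, e1⟩ := hv i j hj
      rw [e1]
      exact_mod_cast w1.2
    · obtain ⟨w1, hw1, e1⟩ := hv i 0 (Nat.zero_le _)
      have h := hfR (Sum.inr i)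
      rw [zero_add, Function.iterate_one] at hw1
      rw [hw1] at h
      rw [e1]
      exact h
    · obtain ⟨w1, hw1, e1⟩ := hv i (r i - 2) le_rfl
      obtain ⟨i', hi'⟩ := hr1 i
      have h2 := hr i
      have h := hfR (f^[r i - 2 + 1] (Sum.inr i))
      rw [← Function.iterate_succ_apply' f, hw1, show (r i - 2 + 1).succ = r i by omega, hi'] at h
      rw [e1]
      exact h
  choose P hP using hpath
  refine ⟨P, fun i => ?_, fun i i' hne => ?_⟩
  · rw [hP]
    exact ⟨_, 0, Nat.zero_le _, rfl⟩
  · rw [hP, hP, Set.disjoint_left]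
    rintro _ ⟨j, hj, rfl⟩ ⟨j', hj', h⟩
    exact hne (hinj i i' j j' hj hj' h.symm).1

/-- The paths of length one and paths with nonempty interiors together. -/
theorem exists_finset_pathBetween [DecidableRel G.Adj]
    {A B : Finset V} {k : ℕ} (P : Fin k → PathBetween G (A : Set V) (B : Set V))
    (hne : ∀ i, (P i).interior.Nonempty)
    (hdisj : ∀ i j, i ≠ j → Disjoint (P i).interior (P j).interior) :
    ∃ Q : Finset (PathBetween G (A : Set V) (B : Set V)),
      (Q : Set (PathBetween G (A : Set V) (B : Set V))).PairwiseDisjoint PathBetween.interior ∧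
        Q.card = k + ((A ×ˢ B).filter fun e => G.Adj e.1 e.2).card := by
  classical
  let E := (A ×ˢ B).filter fun e => G.Adj e.1 e.2
  have hE : ∀ e : E, e.1.1 ∈ A ∧ e.1.2 ∈ B ∧ G.Adj e.1.1 e.1.2 := fun e => by
    have := e.2
    simp only [E, Finset.mem_filter, Finset.mem_product] at this
    tauto
  let F : E → PathBetween G (A : Set V) (B : Set V) := fun e =>
    { first := e.1.1
      last := e.1.2
      walk := (hE e).2.2.toWalk
      isPath := by simp [(hE e).2.2.ne]
      first_mem := (hE e).1
      last_mem := (hE e).2.1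
      avoids := fun v hv h1 h2 => by simp at hv; tauto }
  have hF : ∀ e, (F e).interior = ∅ := fun e => by
    ext v
    simp [PathBetween.interior, F]
    tauto
  let Φ : Fin k ⊕ E → PathBetween G (A : Set V) (B : Set V) := Sum.elim P F
  have hΦd : ∀ x y, x ≠ y → Disjoint (Φ x).interior (Φ y).interior := by
    rintro (i | e) (j | e') hxy
    · exact hdisj i j fun h => hxy (by rw [h])
    · simp [Φ, hF]
    · simp [Φ, hF]
    · simp [Φ, hF]
  have hΦ : Function.Injective Φ := by
    rintro (i | e) (j | e') h
    · by_contra hij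
      have := hΦd _ _ hij
      rw [h, disjoint_self] at this
      exact (hne j).ne_empty this
    · have := hne i
      rw [show P i = F e' from h, hF] at this
      exact absurd this Set.not_nonempty_empty
    · have := hne j
      rw [← show F e = P j from h, hF] at this
      exact absurd this Set.not_nonempty_empty
    · have h1 : (F e).first = (F e').first := congrArg _ h
      have h2 : (F e).last = (F e').last := congrArg _ h
      exact congrArg _ (Subtype.ext (Prod.ext h1 h2))
  refine ⟨Finset.univ.map ⟨Φ, hΦ⟩, ?_, ?_⟩
  swap
  · rw [Finset.card_map, Finset.card_univ, Fintype.card_sum, Fintype.card_fin, Fintype.card_coe]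
  intro p hp q hq hpq
  simp only [Finset.coe_map, Function.Embedding.coeFn_mk, Finset.coe_univ, Set.image_univ,
    Set.mem_range] at hp hq
  obtain ⟨x, rfl⟩ := hp
  obtain ⟨y, rfl⟩ := hq
  exact hΦd x y fun h => hpq (by rw [h])

end DisjointPaths

/-! ### The separation bound and the conclusion -/

/-- For a set `S` containing `A` with no edges from `S \ A` to `B`, the vertices of the outer
neighbourhood of `S` outside `B` and the edges from `A` to `B` are together at least as many as
`isoBound` demands. -/
theorem min_isoBound_le_card_add_card_edges {n : ℕ} {A B U : Finset (Finset (Fin n))}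
    [DecidableRel (cube n).Adj] (hA : A.Nonempty) (hB : B.Nonempty) (hAB : Disjoint A B)
    (hUB : Disjoint U B) (hU : ∀ u ∈ U, ∀ b ∈ B, ¬ (cube n).Adj u b) :
    min (isoBound n (A.card : ℝ)) (isoBound n (B.card : ℝ)) ≤
      (((outerNbhd (cube n) (A ∪ U) \ B).card +
        ((A ×ˢ B).filter fun e => (cube n).Adj e.1 e.2).card : ℕ) : ℝ) := by
  set S := A ∪ U with hS
  set N := outerNbhd (cube n) S \ B with hN
  set E := (A ×ˢ B).filter fun e => (cube n).Adj e.1 e.2 with hE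
  have hSB : Disjoint S B := Finset.disjoint_union_left.2 ⟨hAB, hUB⟩
  have hA1 : (1 : ℝ) ≤ A.card := by exact_mod_cast Finset.card_pos.2 hA
  have hB1 : (1 : ℝ) ≤ B.card := by exact_mod_cast Finset.card_pos.2 hB
  have hmemA : ∀ u ∈ S, ∀ b ∈ B, (cube n).Adj u b → (u, b) ∈ E := by
    intro u hu b hb h
    rcases Finset.mem_union.1 hu with hu | hu
    · simp [hE, hu, hb, h]
    · exact absurd h (hU u hu b hb)
  by_cases hcard : 2 * S.card ≤ 2 ^ n
  · refine (min_le_left _ _).trans ((isoBound_le_card_outerNbhd hA1 (by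
      exact_mod_cast Finset.card_le_card Finset.subset_union_left) hcard).trans ?_)
    have h1 : outerNbhd (cube n) S ⊆ N ∪ E.image Prod.snd := by
      intro v hv
      by_cases hvB : v ∈ B
      · obtain ⟨-, u, hu, huv⟩ := mem_outerNbhd.1 hv
        exact Finset.mem_union_right _ (Finset.mem_image.2 ⟨_, hmemA u hu v hvB huv, rfl⟩)
      · exact Finset.mem_union_left _ (Finset.mem_sdiff.2 ⟨hv, hvB⟩)
    have h2 := (Finset.card_le_card h1).trans (Finset.card_union_le _ _)
    have h3 : (E.image Prod.snd).card ≤ E.card := Finset.card_image_le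
    exact_mod_cast h2.trans (by omega)
  -- When `S` is large, the far side `T` is small and contains `B`. A vertex of `S` adjacent to `T`
  -- must be adjacent to a vertex of `B`, since all other outer neighbours of `S` lie in `N`; it is
  -- therefore the end in `A` of an edge counted in `E`.
  · set T := (S ∪ N)ᶜ with hT
    have hBT : B ⊆ T := fun b hb => by
      simp only [hT, hN, Finset.mem_compl, Finset.mem_union, Finset.mem_sdiff]
      rintro (h | h)
      · exact Finset.disjoint_left.1 hSB h hb
      · exact h.2 hb
    have hTcard : 2 * T.card ≤ 2 ^ n := by
      have h1 : T.card ≤ Sᶜ.card :=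
        Finset.card_le_card (Finset.compl_subset_compl.2 Finset.subset_union_left)
      have h2 : S.card + Sᶜ.card = 2 ^ n := by
        rw [Finset.card_add_card_compl]; simp
      omega
    refine (min_le_right _ _).trans ((isoBound_le_card_outerNbhd hB1 (by
      exact_mod_cast Finset.card_le_card hBT) hTcard).trans ?_)
    have h1 : outerNbhd (cube n) T ⊆ N ∪ E.image Prod.fst := by
      intro v hv
      obtain ⟨hvT, u, hu, huv⟩ := mem_outerNbhd.1 hv
      by_cases hvN : v ∈ N
      · exact Finset.mem_union_left _ hvN
      · have hvS : v ∈ S := by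
          simp only [hT, Finset.mem_compl, Finset.mem_union, not_not] at hvT
          tauto
        simp only [hT, Finset.mem_compl, Finset.mem_union, not_or] at hu
        have huB : u ∈ B := by
          by_contra h
          exact hu.2 (Finset.mem_sdiff.2 ⟨mem_outerNbhd.2 ⟨hu.1, v, hvS, huv.symm⟩, h⟩)
        exact Finset.mem_union_right _
          (Finset.mem_image.2 ⟨_, hmemA v hvS u huB huv.symm, rfl⟩)
    have h2 := (Finset.card_le_card h1).trans (Finset.card_union_le _ _)
    have h3 : (E.image Prod.fst).card ≤ E.card := Finset.card_image_le
    exact_mod_cast h2.trans (by omega)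

theorem mainTheorem6 (n : ℕ) (A B : Finset (Finset (Fin n))) (hA : A.Nonempty) (hB : B.Nonempty)
    (hAB : Disjoint A B) :
    ∃ P : Finset (PathBetween (cube n) (A : Set (Finset (Fin n))) (B : Set (Finset (Fin n)))),
      (P : Set (PathBetween (cube n) (A : Set (Finset (Fin n)))
        (B : Set (Finset (Fin n))))).PairwiseDisjoint PathBetween.interior ∧
      min (isoBound n (A.card : ℝ)) (isoBound n (B.card : ℝ)) ≤ (P.card : ℝ) := by
  classical
  set β := min (isoBound n (A.card : ℝ)) (isoBound n (B.card : ℝ)) with hβ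
  obtain ⟨P, hne, hdisj⟩ := exists_disjoint_pathBetween (G := cube n) hA hAB
    -- Only the shortfall after using all edges is requested; the subtraction truncates to 0 when
    -- the edges alone suffice.
    (⌈β⌉₊ - ((A ×ˢ B).filter fun e => (cube n).Adj e.1 e.2).card) fun U _ hUB hU => by
      have := Nat.ceil_le.2 (min_isoBound_le_card_add_card_edges hA hB hAB hUB hU)
      rw [← hβ] at this
      omega
  obtain ⟨Q, hQ, hcard⟩ := exists_finset_pathBetween P hne hdisj
  refine ⟨Q, hQ, (Nat.le_ceil β).trans ?_⟩
  rw [hcard]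
  exact_mod_cast (by omega)
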